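/- Consider the following recommendation game with $T$ users. A state $\theta\sim\mathrm{Unif}[-1,1]$, contexts $x_1,\dots,x_T\sim N(0,1)$ and dynamic payoffs $z_1,\dots,z_T\sim N(0,1)$ are drawn, all mutually independent. In round $t$ the payoffs of the two arms are $r_t(1)=x_t\theta+z_t$ and $r_t(-1)=0$. Users know $\theta$; user $t$ also observes $x_t$, but not $z_t$. The recommender observes $x_t$ and $z_t$, and keeps a confidence interval $[l_t,u_t]$ for $\theta$, with $(l_1,u_1)=(-1,1)$ and midpoint $m_t=(l_t+u_t)/2$. Under the binary straightforward policy she sends the message $a_t=1$ if $x_tm_t+z_t>0$ and $a_t=-1$ otherwise. User $t$ knows this signal function, forms the posterior mean $Z_t$ of $z_t$ given $a_t$, that is, $Z_t=\mathbb E[\zeta\mid \zeta>-x_tm_t]$ if $a_t=1$ and $Z_t=\mathbb E[\zeta\mid \zeta\le -x_tm_t]$ if $a_t=-1$, where $\zeta\sim N(0,1)$ and $x_tm_t$ is held fixed, and chooses $b_t=1$ if $x_t\theta+Z_t>0$ and $b_t=-1$ otherwise. The recommender observes $b_t$ and updates $$(l_{t+1},u_{t+1})=\begin{cases}(\max\{l_t,-Z_t/x_t\},\,u_t)&\text{if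 } b_t\,\mathrm{sgn}(x_t)>0,\\ (l_t,\,\min\{u_t,-Z_t/x_t\})&\text{if } b_t\,\mathrm{sgn}(x_t)<0\end{cases}$$ (with no update on the null event $x_t=0$). Let $\mathrm{Reg}(T)=\sum_{t=1}^T\bigl(\max\{r_t(1),r_t(-1)\}-r_t(b_t)\bigr)$. Theorem (Regret Bound of Straightforward Policy). There is a polylogarithmic function $f:\mathbb Z\to(0,\infty)$, i.e. $f(T)=\Theta((\log T)^c)$ as $T\to\infty$ for some $c\in\mathbb R$, such that under the binary straightforward policy, for every integer $T\ge 1$, $\mathrm{Reg}(T)$ is integrable and $$\mathbb E[\mathrm{Reg}(T)]\ \ge\ \frac{T}{f(T)} .$$ -/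

import Mathlib

open MeasureTheory ProbabilityTheory

noncomputable section

/-! Rounds are numbered from `0`: index `t` stands for round `t + 1`. Arms and binary messages are
the elements `1` and `-1` of `ℤˣ = {1, -1}`. -/

namespace DeviationLearning

/-- The payoff `r(b)` of arm `b` in state `θ`, with context `x` and dynamic payoff `z`. -/
def payoff (θ x z : ℝ) (b : ℤˣ) : ℝ :=
  if b = 1 then x * θ + z else 0

/-- The signal function of the straightforward policy, for the estimate `m` of the state. -/
def straightforward (m x : ℝ) : ℝ → ℤˣ :=
  fun z => if x * m + z > 0 then 1 else -1

/-- The posterior mean of the dynamic payoff, whose prior is standard normal, of a user who knows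
the signal function `μ` and receives the message `a`. -/
def posteriorMean (μ : ℝ → ℤˣ) (a : ℤˣ) : ℝ :=
  ∫ z, z ∂((gaussianReal 0 1)[|μ ⁻¹' {a}])

/-- The arm chosen by a user who knows the state `θ`, the context `x` and the signal function `μ`,
and receives the message `a`. -/
def userChoice (θ x : ℝ) (μ : ℝ → ℤˣ) (a : ℤˣ) : ℤˣ :=
  if x * θ + posteriorMean μ a > 0 then 1 else -1

/-- The midpoint of the confidence interval `[I.1, I.2]`. -/
def midpoint (I : ℝ × ℝ) : ℝ := (I.1 + I.2) / 2

/-- The update of the confidence interval `[I.1, I.2]` on observing the arm `b` chosen in context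
`x` by a user whose posterior mean of the dynamic payoff is `Z`. -/
def updateInterval (I : ℝ × ℝ) (x Z : ℝ) (b : ℤˣ) : ℝ × ℝ :=
  (if ((b : ℤ) : ℝ) * Real.sign x > 0 then max I.1 (-Z / x) else I.1,
   if ((b : ℤ) : ℝ) * Real.sign x < 0 then min I.2 (-Z / x) else I.2)

/-- One round under the straightforward policy, started with the confidence interval `I`: the arm
that the user chooses. -/
def roundChoice (θ x z : ℝ) (I : ℝ × ℝ) : ℤˣ :=
  let μ := straightforward (midpoint I) x
  userChoice θ x μ (μ z)

/-- One round under the straightforward policy, started with the confidence interval `I`: the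
confidence interval after the round. -/
def nextInterval (θ x z : ℝ) (I : ℝ × ℝ) : ℝ × ℝ :=
  let μ := straightforward (midpoint I) x
  updateInterval I x (posteriorMean μ (μ z)) (roundChoice θ x z I)

/-- The confidence interval `(l, u)` at the beginning of the round with index `t`. -/
def interval (θ : ℝ) (x z : ℕ → ℝ) : ℕ → ℝ × ℝ
  | 0 => (-1, 1)
  | t + 1 => nextInterval θ (x t) (z t) (interval θ x z t)

/-- The regret in the round with index `t`: the payoff of the better arm minus that of the chosen
arm. -/
def roundRegret (θ : ℝ) (x z : ℕ → ℝ) (t : ℕ) : ℝ :=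
  max (payoff θ (x t) (z t) 1) (payoff θ (x t) (z t) (-1))
    - payoff θ (x t) (z t) (roundChoice θ (x t) (z t) (interval θ x z t))

/-- The cumulative regret over the first `T` rounds. -/
def regret (θ : ℝ) (x z : ℕ → ℝ) (T : ℕ) : ℝ :=
  ∑ t ∈ Finset.range T, roundRegret θ x z t

/-- The random environment with `T` users: the state is uniform on `[-1, 1]`, contexts and dynamic
payoffs of the `T` rounds are standard normal, and all of these are mutually independent. -/
structure IsEnvironment {Ω : Type*} [MeasurableSpace Ω] (P : Measure Ω) (T : ℕ)
    (θ : Ω → ℝ) (x z : ℕ → Ω → ℝ) : Prop where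
  measurable_state : Measurable θ
  measurable_context : ∀ t < T, Measurable (x t)
  measurable_dynamic : ∀ t < T, Measurable (z t)
  law_state : P.map θ = (volume : Measure ℝ)[|Set.Icc (-1) 1]
  law_context : ∀ t < T, P.map (x t) = gaussianReal 0 1
  law_dynamic : ∀ t < T, P.map (z t) = gaussianReal 0 1
  indep : iIndepFun (fun i : Option (Fin T ⊕ Fin T) =>
    i.elim θ (Sum.elim (fun t => x t) (fun t => z t))) P

/-- `f` is `Θ̃(1)`: it is of exact order `(log T) ^ c` as `T → ∞`, for some real `c`. -/
def IsPolylog (f : ℤ → ℝ) : Prop :=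
  ∃ c : ℝ, f =Θ[Filter.atTop] fun T : ℤ => Real.log (T : ℝ) ^ c

end DeviationLearning

end

noncomputable section

namespace DeviationLearning

open Set Filter Polynomial

-- Standard normal density and integration by parts

local notation "γ" => gaussianReal 0 1
local notation "φ" => gaussianPDFReal 0 1

/-! The recommender learns `θ` only by comparing it with the cuts `-Z/x`, and no cut comes near the
current midpoint `m`. Indeed `|Z + x m|` is the mean excess of a normal variable over a threshold of
size at most `K` when `|x| ≤ K`, and this excess is at least of order `K⁻²` (`le_truncMean_sub`).
The cut therefore stays at distance `g = 1/(24 K³)` from `m`.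

Fix contexts bounded by `K` and any dynamic payoffs. Following at each cut the part that contains
the midpoint gives an interval of length at least `g` whose interior states all produce this same
confidence interval (`exists_interval_eq`). The state is independent of the past, so with
probability of order `g` it lies in the left quarter-`g` of this interval, and `m` then
overestimates it by at least `g/4`.

Given this, a context in `[1/8, 1/4]` makes the user obey, and a payoff `z` just above `-x m` makes
the message wrong by at least `g/64` (`le_stepRegret`). The window for `z` has probability of order
`g`, so each round costs of order `g³`, that is `K⁻⁹`. By Gaussian tails `K = log T + 3` bounds all
contexts with probability at least one half, so the total is at least of order `T / (log T + 3)⁹`.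
-/

theorem stdGaussianPDF_eq (x : ℝ) : φ x = (√(2 * Real.pi))⁻¹ * Real.exp (-(1 / 2) * x ^ 2) := by
  simp only [gaussianPDFReal, NNReal.coe_one, mul_one, sub_zero]
  congr 2
  ring

theorem integrable_eval_mul_stdGaussianPDF (p : ℝ[X]) :
    Integrable (fun x => p.eval x * φ x) := by
  induction p using Polynomial.induction_on' with
  | add p q hp hq => exact (hp.add hq).congr (Eventually.of_forall fun x => by simp [add_mul])
  | monomial n a =>
    have h := integrable_rpow_mul_exp_neg_mul_sq (b := 1 / 2) (by norm_num) (s := (n : ℝ))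
      (by linarith [Nat.cast_nonneg (α := ℝ) n])
    refine (h.const_mul (a * (√(2 * Real.pi))⁻¹)).congr (Eventually.of_forall fun x => ?_)
    simp only [eval_monomial, stdGaussianPDF_eq, Real.rpow_natCast]
    ring

theorem hasDerivAt_stdGaussianPDF (x : ℝ) : HasDerivAt φ (-x * φ x) x := by
  have h : HasDerivAt (fun x : ℝ => (√(2 * Real.pi))⁻¹ * Real.exp (-(1 / 2) * x ^ 2))
      ((√(2 * Real.pi))⁻¹ * (Real.exp (-(1 / 2) * x ^ 2) * (-(1 / 2) * (2 * x)))) x := by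
    have := ((hasDerivAt_pow 2 x).const_mul (-(1 / 2) : ℝ)).exp.const_mul (√(2 * Real.pi))⁻¹
    simpa using this
  have e : φ = fun x : ℝ => (√(2 * Real.pi))⁻¹ * Real.exp (-(1 / 2) * x ^ 2) :=
    funext stdGaussianPDF_eq
  rw [e]
  convert h using 1
  ring

/-- Gaussian integration by parts on a half-line, for polynomials. -/
theorem integral_Ioi_derivative_sub_X_mul (p : ℝ[X]) (c : ℝ) :
    ∫ x in Ioi c, (derivative p - X * p).eval x * φ x = -(p.eval c * φ c) := by
  have hd : ∀ x ∈ Ici c, HasDerivAt (fun x => p.eval x * φ x)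
      ((derivative p - X * p).eval x * φ x) x := fun x _ => by
    refine ((p.hasDerivAt x).mul (hasDerivAt_stdGaussianPDF x)).congr_deriv ?_
    rw [eval_sub, eval_mul, eval_X]
    ring
  have h0 := tendsto_zero_of_hasDerivAt_of_integrableOn_Ioi
    (fun x hx => hd x (Ioi_subset_Ici_self hx))
    (integrable_eval_mul_stdGaussianPDF (derivative p - X * p)).integrableOn
    (integrable_eval_mul_stdGaussianPDF p).integrableOn
  rw [integral_Ioi_of_hasDerivAt_of_tendsto' hd
    (integrable_eval_mul_stdGaussianPDF (derivative p - X * p)).integrableOn h0]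
  ring

theorem setIntegral_stdGaussian (f : ℝ → ℝ) {s : Set ℝ} (hs : MeasurableSet s) :
    ∫ x in s, f x ∂γ = ∫ x in s, f x * φ x := by
  rw [gaussianReal_of_var_ne_zero _ one_ne_zero,
    setIntegral_withDensity_eq_setIntegral_toReal_smul (measurable_gaussianPDF 0 1)
      (Eventually.of_forall fun _ => gaussianPDF_lt_top) _ hs]
  simp only [toReal_gaussianPDF, smul_eq_mul, mul_comm]

theorem real_stdGaussian {s : Set ℝ} (hs : MeasurableSet s) :
    (γ).real s = ∫ x in s, φ x := by
  simpa using setIntegral_stdGaussian (fun _ => 1) hs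

theorem real_stdGaussian_Ioi_pos (c : ℝ) : 0 < (γ).real (Ioi c) := by
  have hsupp : Function.support φ = univ := eq_univ_of_forall fun x =>
    (gaussianPDFReal_pos 0 1 x one_ne_zero).ne'
  rw [real_stdGaussian measurableSet_Ioi, setIntegral_pos_iff_support_of_nonneg_ae
    (Eventually.of_forall fun x => gaussianPDFReal_nonneg 0 1 x)
    (integrable_gaussianPDFReal 0 1).integrableOn, hsupp]
  simp

/-! ### Truncated normal means -/

/-- The mean of the standard normal distribution truncated to `(c, ∞)`. -/
def truncMean (c : ℝ) : ℝ := ∫ z, z ∂((γ)[|Ioi c])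

theorem truncMean_eq (c : ℝ) : truncMean c = φ c / (γ).real (Ioi c) := by
  have h : ∫ x in Ioi c, x ∂γ = φ c := by
    rw [setIntegral_stdGaussian _ measurableSet_Ioi]
    simpa [integral_neg] using integral_Ioi_derivative_sub_X_mul (1 : ℝ[X]) c
  rw [truncMean, ProbabilityTheory.cond, integral_smul_measure, h, ENNReal.toReal_inv, smul_eq_mul,
    Measure.real, div_eq_inv_mul]

theorem measurable_truncMean : Measurable truncMean := by
  have h : Antitone fun c => (γ).real (Ioi c) := fun a b hab =>
    measureReal_mono (Ioi_subset_Ioi hab)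
  have e : truncMean = fun c => φ c / (γ).real (Ioi c) := funext truncMean_eq
  rw [e]
  exact (measurable_gaussianPDFReal 0 1).div h.measurable

theorem stdGaussianPDF_le_truncMean (c : ℝ) : φ c ≤ truncMean c := by
  rw [truncMean_eq, le_div_iff₀ (real_stdGaussian_Ioi_pos c)]
  exact mul_le_of_le_one_right (gaussianPDFReal_nonneg 0 1 c) measureReal_le_one

/-- The mean excess of a standard normal variable over a threshold `c`. -/
theorem div_le_truncMean_sub (c : ℝ) : c / (2 + c ^ 2) ≤ truncMean c - c := by
  have hP := real_stdGaussian_Ioi_pos c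
  -- The third moment of the excess is nonnegative. It equals `(2 + c²) φ(c) - (3c + c³) P(Ioi c)`,
  -- which bounds `φ(c) / P(Ioi c)` from below.
  have hpos : 0 ≤ ∫ x in Ioi c, ((X - C c) ^ 3 : ℝ[X]).eval x * φ x := by
    refine setIntegral_nonneg measurableSet_Ioi fun x hx => ?_
    have : 0 ≤ x - c := sub_nonneg.2 (le_of_lt hx)
    simp only [eval_pow, eval_sub, eval_X, eval_C]
    exact mul_nonneg (by positivity) (gaussianPDFReal_nonneg 0 1 x)
  -- Up to a constant, `(X - c)³` is the sum of the two polynomials `p' - X p`. The first `p`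
  -- vanishes at `c`, so only the second leaves a boundary term.
  have h1 := integral_Ioi_derivative_sub_X_mul (-((X - C c) * (X - C (2 * c))) : ℝ[X]) c
  have h2 := integral_Ioi_derivative_sub_X_mul (-C (2 + c ^ 2) : ℝ[X]) c
  have hsplit : ∫ x in Ioi c, ((X - C c) ^ 3 : ℝ[X]).eval x * φ x =
      (2 + c ^ 2) * φ c - (c + (2 + c ^ 2) * c) * (γ).real (Ioi c) := by
    have i1 := (integrable_eval_mul_stdGaussianPDF (derivative (-((X - C c) * (X - C (2 * c))))
      - X * (-((X - C c) * (X - C (2 * c)))))).integrableOn (s := Ioi c)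
    have i2 := (integrable_eval_mul_stdGaussianPDF (derivative (-C (2 + c ^ 2))
      - X * (-C (2 + c ^ 2)))).integrableOn (s := Ioi c)
    have i3 := ((integrable_gaussianPDFReal 0 1).const_mul
      (c + (2 + c ^ 2) * c)).integrableOn (s := Ioi c)
    calc _ = ∫ x in Ioi c, ((derivative (-((X - C c) * (X - C (2 * c))))
              - X * (-((X - C c) * (X - C (2 * c))))).eval x * φ x
            + (derivative (-C (2 + c ^ 2)) - X * (-C (2 + c ^ 2)) : ℝ[X]).eval x * φ x
            - (c + (2 + c ^ 2) * c) * φ x) := by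
          refine integral_congr_ae (Eventually.of_forall fun x => ?_)
          simp [derivative_pow]
          ring
      _ = _ := by
          rw [integral_sub (by exact i1.add i2) i3, integral_add i1 i2, h1, h2, integral_const_mul,
            ← real_stdGaussian measurableSet_Ioi]
          simp
          ring
  rw [hsplit] at hpos
  rw [truncMean_eq, div_le_iff₀ (by positivity), div_sub' hP.ne', div_mul_eq_mul_div,
    le_div_iff₀ hP]
  linarith

theorem le_stdGaussianPDF {c : ℝ} (hc : |c| ≤ 1 / 2) : 3 / 10 ≤ φ c := by
  have hs : √(2 * Real.pi) ≤ 2.6 := by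
    rw [Real.sqrt_le_left (by norm_num)]
    nlinarith [Real.pi_lt_d2]
  have hs0 : 0 < √(2 * Real.pi) := Real.sqrt_pos.2 (by positivity)
  have hc2 : c ^ 2 ≤ (1 / 2) ^ 2 := sq_le_sq' (abs_le.1 hc).1 (abs_le.1 hc).2
  have he := Real.add_one_le_exp (-(1 / 2) * c ^ 2)
  rw [stdGaussianPDF_eq, inv_mul_eq_div, le_div_iff₀ hs0]
  nlinarith

theorem posteriorMean_straightforward_one (m x : ℝ) :
    posteriorMean (straightforward m x) 1 = truncMean (-(x * m)) := by
  have h : straightforward m x ⁻¹' {1} = Ioi (-(x * m)) := by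
    ext z
    simp only [straightforward, mem_preimage, mem_singleton_iff, mem_Ioi]
    constructor
    · intro h
      by_contra h'
      rw [if_neg (by linarith)] at h
      exact absurd h (by decide)
    · intro h
      exact if_pos (by linarith)
  rw [posteriorMean, h, truncMean]

/-- The reflection `z ↦ -z` preserves the normal law and turns the lower tail into an upper one. -/
theorem posteriorMean_straightforward_neg_one (m x : ℝ) :
    posteriorMean (straightforward m x) (-1) = -truncMean (x * m) := by
  have h : straightforward m x ⁻¹' {-1} = Iic (-(x * m)) := by
    ext z
    simp only [straightforward, mem_preimage, mem_singleton_iff, mem_Iic]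
    constructor
    · intro h
      by_contra h'
      rw [if_pos (by linarith)] at h
      exact absurd h (by decide)
    · intro h
      exact if_neg (by linarith)
  have := nullSingletonClass_gaussianReal (μ := 0) (v := 1) one_ne_zero
  have hmap : (γ).map (fun z => -z) = γ := by simpa using gaussianReal_map_neg (μ := 0) (v := 1)
  have hpre : (fun z : ℝ => -z) ⁻¹' Ioi (x * m) = Iio (-(x * m)) := by
    ext z; simp [lt_neg]
  have hms : (γ) (Iic (-(x * m))) = (γ) (Ioi (x * m)) := by
    conv_rhs => rw [← hmap]
    rw [Measure.map_apply measurable_neg measurableSet_Ioi, hpre]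
    exact measure_congr Iio_ae_eq_Iic.symm
  have hint : ∫ z in Ioi (x * m), z ∂γ = -∫ z in Iic (-(x * m)), z ∂γ := by
    conv_lhs => rw [← hmap]
    rw [setIntegral_map (f := fun z : ℝ => z) measurableSet_Ioi aestronglyMeasurable_id measurable_neg.aemeasurable, hpre,
      integral_neg, setIntegral_congr_set Iio_ae_eq_Iic]
  rw [posteriorMean, h, truncMean, ProbabilityTheory.cond, ProbabilityTheory.cond,
    integral_smul_measure, integral_smul_measure, hms, hint, smul_neg, neg_neg]

/-- For `c ≥ 1/8` the cubic-moment bound applies; `1/8` suffices because `24 / 8 * K² ≥ 2 + K²`. For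
smaller `c`, either `-c` alone is at least `1/2`, or the density at `c` is at least `3/10` and beats
`1/8`. -/
theorem le_truncMean_sub {K c : ℝ} (hK : 1 ≤ K) (hc : |c| ≤ K) :
    1 / (24 * K ^ 2) ≤ truncMean c - c := by
  have hK2 : 1 ≤ K ^ 2 := one_le_pow₀ hK
  have hle : 1 / (24 * K ^ 2) ≤ 1 / 24 := by gcongr; linarith
  rcases le_total c (1 / 8) with h | h
  · have hφ := stdGaussianPDF_le_truncMean c
    rcases le_total c (-(1 / 2)) with h' | h'
    · linarith [gaussianPDFReal_nonneg 0 1 c]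
    · linarith [le_stdGaussianPDF (abs_le.2 ⟨h', by linarith⟩)]
  · refine le_trans ?_ (div_le_truncMean_sub c)
    have hcK : c ^ 2 ≤ K ^ 2 := sq_le_sq' (by linarith [(abs_le.1 hc).1]) (abs_le.1 hc).2
    rw [div_le_div_iff₀ (by positivity) (by positivity)]
    nlinarith

/-! ### Cuts and the evolution of the confidence interval -/

/-- The posterior mean of the dynamic payoff `z`, in context `x` and for the estimate `m`, after the
message of the straightforward policy. -/
def signalMean (m x z : ℝ) : ℝ :=
  posteriorMean (straightforward m x) (straightforward m x z)

theorem signalMean_eq (m x z : ℝ) :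
    signalMean m x z = if x * m + z > 0 then truncMean (-(x * m)) else -truncMean (x * m) := by
  rw [signalMean]
  split_ifs with h
  · rw [show straightforward m x z = 1 from if_pos h, posteriorMean_straightforward_one]
  · rw [show straightforward m x z = -1 from if_neg h, posteriorMean_straightforward_neg_one]

theorem roundChoice_eq (θ x z : ℝ) (I : ℝ × ℝ) :
    roundChoice θ x z I = if x * θ + signalMean (midpoint I) x z > 0 then 1 else -1 := rfl

theorem nextInterval_eq (θ x z : ℝ) (I : ℝ × ℝ) :
    nextInterval θ x z I =
      updateInterval I x (signalMean (midpoint I) x z) (roundChoice θ x z I) := rfl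

/-- The cut at which a round divides the states stays away from the current estimate. -/
theorem le_abs_neg_signalMean_div_sub {K m x : ℝ} (hK : 1 ≤ K) (hx : |x| ≤ K) (hx0 : x ≠ 0)
    (hm : |m| ≤ 1) (z : ℝ) : 1 / (24 * K ^ 3) ≤ |-signalMean m x z / x - m| := by
  have hK0 : 0 < K := by linarith
  have hxm : |x * m| ≤ K := by
    rw [abs_mul]
    exact (mul_le_of_le_one_right (abs_nonneg x) hm).trans hx
  have hx0' : 0 < |x| := abs_pos.2 hx0
  have key : 1 / (24 * K ^ 2) ≤ |signalMean m x z + x * m| := by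
    rw [signalMean_eq]
    split_ifs
    · refine (le_truncMean_sub hK (c := -(x * m)) (by rwa [abs_neg])).trans ?_
      rw [sub_neg_eq_add]
      exact le_abs_self _
    · refine (le_truncMean_sub hK hxm).trans ?_
      rw [← abs_neg, neg_add, neg_neg, ← sub_eq_add_neg]
      exact le_abs_self _
  have e : -signalMean m x z / x - m = -(signalMean m x z + x * m) / x := by
    field_simp
    ring
  rw [e, abs_div, abs_neg, le_div_iff₀ hx0']
  refine le_trans ?_ key
  calc 1 / (24 * K ^ 3) * |x| ≤ 1 / (24 * K ^ 3) * K := by gcongr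
    _ = 1 / (24 * K ^ 2) := by field_simp

theorem nextInterval_zero (θ z : ℝ) (I : ℝ × ℝ) : nextInterval θ 0 z I = I := by
  simp [nextInterval_eq, updateInterval]

/-- A negative context reverses both the comparison with the cut and the sign in the update rule, so
only the side of the cut on which `θ` lies matters. -/
theorem nextInterval_of_cut_lt {θ x z : ℝ} {I : ℝ × ℝ} (hx : x ≠ 0)
    (h : -signalMean (midpoint I) x z / x < θ) :
    nextInterval θ x z I = (max I.1 (-signalMean (midpoint I) x z / x), I.2) := by
  rw [nextInterval_eq, roundChoice_eq]
  rcases hx.lt_or_gt with h0 | h0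
  · rw [div_lt_iff_of_neg h0] at h
    rw [if_neg (by linarith)]
    simp [updateInterval, Real.sign_of_neg h0]
  · rw [div_lt_iff₀ h0] at h
    rw [if_pos (by linarith)]
    simp [updateInterval, Real.sign_of_pos h0]

theorem nextInterval_of_lt_cut {θ x z : ℝ} {I : ℝ × ℝ} (hx : x ≠ 0)
    (h : θ < -signalMean (midpoint I) x z / x) :
    nextInterval θ x z I = (I.1, min I.2 (-signalMean (midpoint I) x z / x)) := by
  rw [nextInterval_eq, roundChoice_eq]
  rcases hx.lt_or_gt with h0 | h0
  · rw [lt_div_iff_of_neg h0] at h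
    rw [if_pos (by linarith)]
    simp [updateInterval, Real.sign_of_neg h0]
  · rw [lt_div_iff₀ h0] at h
    rw [if_neg (by linarith)]
    simp [updateInterval, Real.sign_of_pos h0]

/-- If the contexts are bounded, some confidence interval that is not short traps all states in its
interior: of the two parts into which a round cuts an interval, the longer one is not short. -/
theorem exists_interval_eq {K : ℝ} (hK : 1 ≤ K) (x z : ℕ → ℝ) (t : ℕ) (hx : ∀ s < t, |x s| ≤ K) :
    ∃ l u : ℝ, -1 ≤ l ∧ u ≤ 1 ∧ 1 / (24 * K ^ 3) ≤ u - l ∧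
      ∀ θ, l < θ → θ < u → interval θ x z t = (l, u) := by
  induction t with
  | zero =>
    refine ⟨-1, 1, le_rfl, le_rfl, ?_, fun _ _ _ => rfl⟩
    rw [div_le_iff₀ (by positivity)]
    linarith [one_le_pow₀ hK (n := 3)]
  | succ t ih =>
    obtain ⟨l, u, hl, hu, hlu, hI⟩ := ih fun s hs => hx s (hs.trans (Nat.lt_succ_self t))
    have hg : 0 < 1 / (24 * K ^ 3) := by positivity
    have hm : |midpoint (l, u)| ≤ 1 := by
      simp only [midpoint]
      exact abs_le.2 ⟨by linarith, by linarith⟩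
    have hnext : ∀ θ, l < θ → θ < u →
        interval θ x z (t + 1) = nextInterval θ (x t) (z t) (l, u) := fun θ h1 h2 => by
      rw [interval, hI θ h1 h2]
    rcases eq_or_ne (x t) 0 with h0 | h0
    · exact ⟨l, u, hl, hu, hlu, fun θ h1 h2 => by rw [hnext θ h1 h2, h0, nextInterval_zero]⟩
    have hgap := le_abs_neg_signalMean_div_sub hK (hx t (Nat.lt_succ_self t)) h0 hm (z t)
    have hcut := fun θ => nextInterval_of_cut_lt (θ := θ) (z := z t) (I := (l, u)) h0
    have hcut' := fun θ => nextInterval_of_lt_cut (θ := θ) (z := z t) (I := (l, u)) h0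
    set c := -signalMean (midpoint (l, u)) (x t) (z t) / x t
    simp only [midpoint] at hgap
    rcases le_or_gt c l with hcl | hcl
    · refine ⟨l, u, hl, hu, hlu, fun θ h1 h2 => ?_⟩
      rw [hnext θ h1 h2, hcut θ (hcl.trans_lt h1), max_eq_left hcl]
    rcases le_or_gt u c with hcu | hcu
    · refine ⟨l, u, hl, hu, hlu, fun θ h1 h2 => ?_⟩
      rw [hnext θ h1 h2, hcut' θ (h2.trans_le hcu), min_eq_left hcu]
    -- The part kept contains the midpoint, so its length is at least the distance from midpoint to
    -- cut. This bound ignores the previous length, so nothing is lost as rounds accumulate.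
    rcases le_abs.1 hgap with h | h
    · refine ⟨l, c, hl, by linarith, by linarith, fun θ h1 h2 => ?_⟩
      rw [hnext θ h1 (h2.trans hcu), hcut' θ h2, min_eq_right hcu.le]
    · refine ⟨c, u, by linarith, hu, by linarith, fun θ h1 h2 => ?_⟩
      rw [hnext θ (hcl.trans h1) h2, hcut θ h1, max_eq_right hcl.le]

/-! ### Regret of a single round -/

/-- The regret of a round that starts with the confidence interval `I`. -/
def stepRegret (θ x z : ℝ) (I : ℝ × ℝ) : ℝ :=
  max (payoff θ x z 1) (payoff θ x z (-1)) - payoff θ x z (roundChoice θ x z I)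

theorem stepRegret_eq (θ x z : ℝ) (I : ℝ × ℝ) :
    stepRegret θ x z I = max (x * θ + z) 0 -
      if x * θ + signalMean (midpoint I) x z > 0 then x * θ + z else 0 := by
  rw [stepRegret, roundChoice_eq]
  have h1 : payoff θ x z 1 = x * θ + z := if_pos rfl
  have h2 : payoff θ x z (-1) = 0 := if_neg (by decide)
  split_ifs <;> simp only [h1, h2]

theorem stepRegret_nonneg (θ x z : ℝ) (I : ℝ × ℝ) : 0 ≤ stepRegret θ x z I := by
  rw [stepRegret_eq]
  split_ifs
  · linarith [le_max_left (x * θ + z) 0]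
  · linarith [le_max_right (x * θ + z) 0]

theorem stepRegret_le (θ x z : ℝ) (I : ℝ × ℝ) : stepRegret θ x z I ≤ |x| * |θ| + |z| := by
  have h : |x * θ + z| ≤ |x| * |θ| + |z| := (abs_add_le _ _).trans (by rw [abs_mul])
  have h' := abs_le.1 h
  rw [stepRegret_eq]
  split_ifs <;> rcases max_cases (x * θ + z) 0 with h | h <;> linarith

/-- A user in a small context follows the message, which costs regret if the message is wrong. -/
theorem le_stepRegret {g θ x z : ℝ} {I : ℝ × ℝ} (hg : 0 < g) (hx : x ∈ Icc (1 / 8 : ℝ) (1 / 4))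
    (hθ : |θ| ≤ 1) (hm : |midpoint I| ≤ 1) (hmθ : g / 4 ≤ midpoint I - θ)
    (hz : z ∈ Ioc (-(x * midpoint I)) (-(x * midpoint I) + g / 64)) :
    g / 64 ≤ stepRegret θ x z I := by
  obtain ⟨hx1, hx2⟩ := hx
  obtain ⟨hz1, hz2⟩ := hz
  have hx0 : 0 < x := by linarith
  have hbd : ∀ y : ℝ, |y| ≤ 1 → |x * y| ≤ 1 / 4 := fun y hy => by
    rw [abs_mul, abs_of_pos hx0]
    nlinarith [abs_nonneg y]
  have hφ := le_stdGaussianPDF (c := -(x * midpoint I))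
    (by rw [abs_neg]; linarith [hbd _ hm])
  have hφ' := stdGaussianPDF_le_truncMean (-(x * midpoint I))
  -- The posterior mean is at least `3/10`, which exceeds `1/4 ≥ |x θ|`, so the user picks arm `1`.
  -- Its payoff is at most `-(1/8)(g/4) + g/64 = -g/64`.
  rw [stepRegret_eq, signalMean_eq, if_pos (by linarith : x * midpoint I + z > 0),
    if_pos (by linarith [(abs_le.1 (hbd θ hθ)).1])]
  nlinarith [le_max_right (x * θ + z) 0]

/-! ### Measurability and dependence on the past -/

theorem measurable_midpoint : Measurable midpoint := by
  unfold midpoint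
  fun_prop

theorem measurable_signalMean {α : Type*} [MeasurableSpace α] {m x z : α → ℝ} (hm : Measurable m)
    (hx : Measurable x) (hz : Measurable z) :
    Measurable fun a => signalMean (m a) (x a) (z a) := by
  simp only [signalMean_eq]
  exact Measurable.ite (measurableSet_lt measurable_const ((hx.mul hm).add hz))
    (measurable_truncMean.comp (hx.mul hm).neg) (measurable_truncMean.comp (hx.mul hm)).neg

theorem measurable_stepRegret {α : Type*} [MeasurableSpace α] {θ x z : α → ℝ} {I : α → ℝ × ℝ}
    (hθ : Measurable θ) (hx : Measurable x) (hz : Measurable z) (hI : Measurable I) :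
    Measurable fun a => stepRegret (θ a) (x a) (z a) (I a) := by
  simp only [stepRegret_eq]
  have hZ := measurable_signalMean (measurable_midpoint.comp hI) hx hz
  exact (((hx.mul hθ).add hz).max measurable_const).sub
    (Measurable.ite (measurableSet_lt measurable_const ((hx.mul hθ).add hZ))
      ((hx.mul hθ).add hz) measurable_const)

theorem measurable_sign : Measurable Real.sign := by
  unfold Real.sign
  exact Measurable.ite measurableSet_Iio measurable_const
    (Measurable.ite measurableSet_Ioi measurable_const measurable_const)

theorem measurable_nextInterval {α : Type*} [MeasurableSpace α] {θ x z : α → ℝ} {I : α → ℝ × ℝ}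
    (hθ : Measurable θ) (hx : Measurable x) (hz : Measurable z) (hI : Measurable I) :
    Measurable fun a => nextInterval (θ a) (x a) (z a) (I a) := by
  have hZ := measurable_signalMean (measurable_midpoint.comp hI) hx hz
  have hb : Measurable fun a => ((roundChoice (θ a) (x a) (z a) (I a) : ℤ) : ℝ) := by
    have e : ∀ a, ((roundChoice (θ a) (x a) (z a) (I a) : ℤ) : ℝ) =
        if x a * θ a + signalMean (midpoint (I a)) (x a) (z a) > 0 then 1 else -1 := fun a => by
      rw [roundChoice_eq]
      split_ifs <;> simp
    simp only [e]
    exact Measurable.ite (measurableSet_lt measurable_const ((hx.mul hθ).add hZ))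
      measurable_const measurable_const
  have hbs := hb.mul (measurable_sign.comp hx)
  simp only [nextInterval_eq, updateInterval]
  exact (Measurable.ite (measurableSet_lt measurable_const hbs)
      (hI.fst.max (hZ.neg.div hx)) hI.fst).prodMk
    (Measurable.ite (measurableSet_lt hbs measurable_const)
      (hI.snd.min (hZ.neg.div hx)) hI.snd)

theorem measurable_interval {α : Type*} [MeasurableSpace α] {θ : α → ℝ} {x z : ℕ → α → ℝ} (t : ℕ)
    (hθ : Measurable θ) (hx : ∀ s < t, Measurable (x s)) (hz : ∀ s < t, Measurable (z s)) :
    Measurable fun a => interval (θ a) (fun s => x s a) (fun s => z s a) t := by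
  induction t with
  | zero => exact measurable_const
  | succ t ih =>
    exact measurable_nextInterval hθ (hx t (Nat.lt_succ_self t)) (hz t (Nat.lt_succ_self t))
      (ih (fun s hs => hx s (hs.trans (Nat.lt_succ_self t)))
        fun s hs => hz s (hs.trans (Nat.lt_succ_self t)))

theorem interval_congr {θ : ℝ} {x z x' z' : ℕ → ℝ} {t : ℕ} (hx : ∀ s < t, x s = x' s)
    (hz : ∀ s < t, z s = z' s) : interval θ x z t = interval θ x' z' t := by
  induction t with
  | zero => rfl
  | succ t ih =>
    rw [interval, interval, ih (fun s hs => hx s (hs.trans (Nat.lt_succ_self t)))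
      fun s hs => hz s (hs.trans (Nat.lt_succ_self t)), hx t (Nat.lt_succ_self t),
      hz t (Nat.lt_succ_self t)]

/-! ### Independence and probability estimates -/

/-- Fubini for the product law: this replaces conditioning on `U`. -/
theorem mul_le_measureReal_of_indepFun {Ω α β : Type*} [MeasurableSpace Ω] [MeasurableSpace α]
    [MeasurableSpace β] {P : Measure Ω} [IsProbabilityMeasure P] {U : Ω → α} {V : Ω → β}
    (h : IndepFun U V P) (hU : Measurable U) (hV : Measurable V) {A : Set (α × β)}
    (hA : MeasurableSet A) {B : Set α} (hB : MeasurableSet B) {q : ℝ}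
    (hq : ∀ u ∈ B, q ≤ (P.map V).real (Prod.mk u ⁻¹' A)) :
    q * P.real (U ⁻¹' B) ≤ P.real ((fun ω => (U ω, V ω)) ⁻¹' A) := by
  have := Measure.isProbabilityMeasure_map (μ := P) hU.aemeasurable
  have := Measure.isProbabilityMeasure_map (μ := P) hV.aemeasurable
  have key : ENNReal.ofReal q * P (U ⁻¹' B) ≤ P ((fun ω => (U ω, V ω)) ⁻¹' A) := by
    rw [← Measure.map_apply (hU.prodMk hV) hA, ← Measure.map_apply hU hB,
      (indepFun_iff_map_prod_eq_prod_map_map hU.aemeasurable hV.aemeasurable).1 h,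
      Measure.prod_apply hA, ← setLIntegral_const]
    calc _ ≤ ∫⁻ u in B, P.map V (Prod.mk u ⁻¹' A) ∂P.map U :=
          setLIntegral_mono' hB fun u hu => ENNReal.ofReal_le_of_le_toReal (hq u hu)
      _ ≤ _ := setLIntegral_le_lintegral _ _
  have := ENNReal.toReal_mono (measure_ne_top _ _) key
  rw [ENNReal.toReal_mul] at this
  refine le_trans ?_ this
  rw [ENNReal.toReal_ofReal']
  exact mul_le_mul_of_nonneg_right (le_max_left _ _) ENNReal.toReal_nonneg

theorem indepFun_of_measurable_iSup_compl {Ω ι α : Type*} [MeasurableSpace Ω] [MeasurableSpace α]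
    {P : Measure Ω} {F : ι → Ω → ℝ} (hF : iIndepFun F P) (hm : ∀ i, Measurable (F i)) (j : ι)
    {U : Ω → α}
    (hU : Measurable[⨆ i ∈ ({j}ᶜ : Set ι), MeasurableSpace.comap (F i) inferInstance] U) :
    IndepFun U (F j) P := by
  have h := indep_iSup_of_disjoint (fun i => (hm i).comap_le) hF
    (disjoint_compl_left (a := ({j} : Set ι)))
  rw [iSup_singleton] at h
  exact indep_of_indep_of_le_left h hU.comap_le

theorem measurable_iSup_compl {Ω ι : Type*} (F : ι → Ω → ℝ) {i j : ι} (h : i ≠ j) :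
    Measurable[⨆ i ∈ ({j}ᶜ : Set ι), MeasurableSpace.comap (F i) inferInstance] (F i) :=
  Measurable.mono (comap_measurable (F i))
    (le_biSup (fun i => MeasurableSpace.comap (F i) inferInstance) (by simpa using h)) le_rfl

theorem mul_volume_le_stdGaussian {s : Set ℝ} (hs : MeasurableSet s)
    (h : s ⊆ Icc (-(1 / 2)) (1 / 2)) : 3 / 10 * volume.real s ≤ (γ).real s := by
  have hfin : volume s ≠ ⊤ := ((measure_mono h).trans_lt (by simp)).ne
  rw [real_stdGaussian hs]
  have := setIntegral_mono_on (μ := volume) (s := s) (f := fun _ => (3 / 10 : ℝ)) (g := φ)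
    (integrableOn_const hfin) (integrable_gaussianPDFReal 0 1).integrableOn hs
    fun x hx => le_stdGaussianPDF (abs_le.2 (h hx))
  rwa [setIntegral_const, smul_eq_mul, mul_comm] at this

/-- Chernoff's bound with parameters `1` and `-1`. An exponential tail is enough, since a
logarithmic `K` only costs a polylogarithmic factor. -/
theorem stdGaussian_real_lt_abs_le (K : ℝ) :
    (γ).real {x | K < |x|} ≤ 2 * Real.exp (1 / 2 - K) := by
  have hint : ∀ t : ℝ, Integrable (fun x : ℝ => Real.exp (t * x)) γ := fun t =>
    integrable_exp_mul_gaussianReal t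
  have hmgf : ∀ t : ℝ, mgf (fun x : ℝ => x) γ t = Real.exp (t ^ 2 / 2) := fun t => by
    rw [mgf_gaussianReal (μ := 0) (v := 1) (Measure.map_id')]
    simp
  have h1 := measure_ge_le_exp_mul_mgf (X := fun x : ℝ => x) K zero_le_one (hint 1)
  have h2 := measure_le_le_exp_mul_mgf (X := fun x : ℝ => x) (-K) (by norm_num : (-1 : ℝ) ≤ 0)
    (hint (-1))
  rw [hmgf, ← Real.exp_add] at h1 h2
  have e1 : -1 * K + (1 : ℝ) ^ 2 / 2 = 1 / 2 - K := by ring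
  have e2 : - -1 * -K + (-1 : ℝ) ^ 2 / 2 = 1 / 2 - K := by ring
  rw [e1] at h1
  rw [e2] at h2
  have hsub : {x : ℝ | K < |x|} ⊆ {x | K ≤ x} ∪ {x | x ≤ -K} := fun x hx => by
    rcases lt_abs.1 (show K < |x| from hx) with h | h
    · exact Or.inl h.le
    · exact Or.inr (show x ≤ -K by linarith)
  have h3 := (measureReal_mono (μ := γ) hsub).trans (measureReal_union_le _ _)
  linarith

theorem le_measureReal_forall_abs_le {Ω : Type*} [MeasurableSpace Ω] {P : Measure Ω}
    [IsProbabilityMeasure P] {x : ℕ → Ω → ℝ} {t : ℕ} (hm : ∀ s < t, Measurable (x s))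
    (hx : ∀ s < t, P.map (x s) = γ) (K : ℝ) :
    1 - t * (2 * Real.exp (1 / 2 - K)) ≤ P.real {ω | ∀ s < t, |x s ω| ≤ K} := by
  have hmeas : MeasurableSet {ω | ∀ s < t, |x s ω| ≤ K} := by
    have e : {ω | ∀ s < t, |x s ω| ≤ K} = ⋂ s, ⋂ (_ : s < t), {ω | |x s ω| ≤ K} := by
      ext; simp
    rw [e]
    exact MeasurableSet.iInter fun s => MeasurableSet.iInter fun hs =>
      measurableSet_le (hm s hs).abs measurable_const
  have hsub : {ω | ∀ s < t, |x s ω| ≤ K}ᶜ ⊆ ⋃ s ∈ Finset.range t, {ω | K < |x s ω|} := fun ω h => by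
    simpa using h
  have h1 := (measureReal_mono (μ := P) hsub (measure_ne_top _ _)).trans
    (measureReal_biUnion_finset_le _ _)
  have h2 : ∑ s ∈ Finset.range t, P.real {ω | K < |x s ω|} ≤ t * (2 * Real.exp (1 / 2 - K)) := by
    calc _ ≤ ∑ _s ∈ Finset.range t, 2 * Real.exp (1 / 2 - K) := by
          refine Finset.sum_le_sum fun s hs => ?_
          have hs := Finset.mem_range.1 hs
          have := stdGaussian_real_lt_abs_le K
          rw [← hx s hs, map_measureReal_apply (hm s hs)
            (measurableSet_lt measurable_const (by fun_prop))] at this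
          exact this
      _ = _ := by simp
  rw [measureReal_compl hmeas, probReal_univ] at h1
  linarith

theorem real_cond_Icc_Ioo {l u : ℝ} (hl : -1 ≤ l) (hlu : l ≤ u) (hu : u ≤ 1) :
    (u - l) / 2 = ((volume : Measure ℝ)[|Icc (-1) 1]).real (Ioo l u) := by
  have hsub : Ioo l u ⊆ Icc (-1) 1 := fun y hy => ⟨by linarith [hy.1], by linarith [hy.2]⟩
  rw [Measure.real, cond_apply measurableSet_Icc, inter_eq_right.2 hsub, ENNReal.toReal_mul,
    ENNReal.toReal_inv, ← Measure.real, ← Measure.real, Real.volume_real_Ioo_of_le hlu,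
    Real.volume_real_Icc_of_le (by norm_num)]
  ring

theorem measurable_truncate {α : Type*} [MeasurableSpace α] {x : ℕ → α → ℝ} {t : ℕ}
    (hx : ∀ s < t, Measurable (x s)) :
    Measurable fun a => (fun s => if s < t then x s a else 0 : ℕ → ℝ) := by
  refine measurable_pi_iff.2 fun s => ?_
  by_cases hs : s < t
  · simpa only [if_pos hs] using hx s hs
  · simpa only [if_neg hs] using measurable_const

/-- The contexts and the dynamic payoffs of the rounds before round `t`, continued by `0`. -/
def past {Ω : Type*} (x z : ℕ → Ω → ℝ) (t : ℕ) (ω : Ω) : (ℕ → ℝ) × (ℕ → ℝ) :=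
  (fun s => if s < t then x s ω else 0, fun s => if s < t then z s ω else 0)

/-- The σ-algebra is a parameter because the lemma also serves for the one generated by all
primitives but one. -/
theorem measurable_past {Ω : Type*} {m : MeasurableSpace Ω} {x z : ℕ → Ω → ℝ} {t : ℕ} (hx : ∀ s < t, Measurable[m] (x s))
    (hz : ∀ s < t, Measurable[m] (z s)) : Measurable[m] (past x z t) :=
  (measurable_truncate hx).prodMk (measurable_truncate hz)

/-- The state `c` is free, so it can vary while the past stays fixed. -/
theorem interval_past {Ω : Type*} (x z : ℕ → Ω → ℝ) (t : ℕ) (ω : Ω) (c : ℝ) :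
    interval c (past x z t ω).1 (past x z t ω).2 t =
      interval c (fun s => x s ω) (fun s => z s ω) t :=
  interval_congr (fun _ hs => if_pos hs) fun _ hs => if_pos hs

/-! ### Expected regret in a random environment -/

section Environment

variable {Ω : Type*} [MeasurableSpace Ω] {P : Measure Ω} {T : ℕ} {θ : Ω → ℝ} {x z : ℕ → Ω → ℝ}

/-- All random variables of an environment, as one family. -/
def primitives (T : ℕ) (θ : Ω → ℝ) (x z : ℕ → Ω → ℝ) : Option (Fin T ⊕ Fin T) → Ω → ℝ :=
  fun i => i.elim θ (Sum.elim (fun t => x t) (fun t => z t))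

theorem IsEnvironment.measurable_primitives (h : IsEnvironment P T θ x z) :
    ∀ i, Measurable (primitives T θ x z i)
  | none => h.measurable_state
  | some (Sum.inl t) => h.measurable_context t t.2
  | some (Sum.inr t) => h.measurable_dynamic t t.2

theorem IsEnvironment.measurable_roundRegret (h : IsEnvironment P T θ x z) {t : ℕ} (ht : t < T) :
    Measurable fun ω => roundRegret (θ ω) (fun s => x s ω) (fun s => z s ω) t :=
  measurable_stepRegret h.measurable_state (h.measurable_context t ht) (h.measurable_dynamic t ht)
    (measurable_interval t h.measurable_state (fun s hs => h.measurable_context s (hs.trans ht))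
      fun s hs => h.measurable_dynamic s (hs.trans ht))

theorem IsEnvironment.integrable_roundRegret (h : IsEnvironment P T θ x z) {t : ℕ} (ht : t < T) :
    Integrable (fun ω => roundRegret (θ ω) (fun s => x s ω) (fun s => z s ω) t) P := by
  have hint : ∀ X : Ω → ℝ, Measurable X → P.map X = γ → Integrable X P := fun X hX hlaw => by
    have : Integrable (fun y : ℝ => y) (P.map X) := by
      rw [hlaw]
      exact (memLp_id_gaussianReal 1).integrable le_rfl
    exact this.comp_measurable hX
  have hθ : ∀ᵐ ω ∂P, |θ ω| ≤ 1 := by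
    refine ae_of_ae_map (p := fun y => |y| ≤ 1) h.measurable_state.aemeasurable ?_
    rw [h.law_state]
    filter_upwards [ae_cond_mem measurableSet_Icc] with y hy using abs_le.2 hy
  have hx := hint _ (h.measurable_context t ht) (h.law_context t ht)
  have hz := hint _ (h.measurable_dynamic t ht) (h.law_dynamic t ht)
  refine (hx.abs.add hz.abs).mono' (h.measurable_roundRegret ht).aestronglyMeasurable ?_
  filter_upwards [hθ] with ω hω
  have hle := stepRegret_le (θ ω) (x t ω) (z t ω) (interval (θ ω) (fun s => x s ω)
    (fun s => z s ω) t)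
  refine (Real.norm_of_nonneg (stepRegret_nonneg _ _ _ _)).trans_le ?_
  exact hle.trans (add_le_add_left (mul_le_of_le_one_right (abs_nonneg _) hω) _)

/-- The pasts and states for which the estimate exceeds the state by a margin `g / 4`. -/
def overestimated (g : ℝ) (t : ℕ) : Set (((ℕ → ℝ) × (ℕ → ℝ)) × ℝ) :=
  {p | |p.2| ≤ 1 ∧ |midpoint (interval p.2 p.1.1 p.1.2 t)| ≤ 1 ∧
    g / 4 ≤ midpoint (interval p.2 p.1.1 p.1.2 t) - p.2}

theorem measurable_interval_past (t : ℕ) :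
    Measurable fun p : ((ℕ → ℝ) × (ℕ → ℝ)) × ℝ => interval p.2 p.1.1 p.1.2 t :=
  measurable_interval (x := fun s (p : ((ℕ → ℝ) × (ℕ → ℝ)) × ℝ) => p.1.1 s)
    (z := fun s p => p.1.2 s) t measurable_snd (fun s _ => by fun_prop) fun s _ => by fun_prop

theorem measurableSet_overestimated (g : ℝ) (t : ℕ) : MeasurableSet (overestimated g t) := by
  have hm := measurable_midpoint.comp (measurable_interval_past t)
  exact (measurableSet_le measurable_snd.abs measurable_const).inter
    ((measurableSet_le hm.abs measurable_const).inter
      (measurableSet_le measurable_const (hm.sub measurable_snd)))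

theorem IsEnvironment.le_measureReal_overestimated [IsProbabilityMeasure P]
    (h : IsEnvironment P T θ x z) {t : ℕ} (ht : t < T) {K : ℝ} (hK : 1 ≤ K) :
    1 / (24 * K ^ 3) / 8 * P.real {ω | ∀ s < t, |x s ω| ≤ K} ≤
      P.real ((fun ω => (past x z t ω, θ ω)) ⁻¹' overestimated (1 / (24 * K ^ 3)) t) := by
  set g := 1 / (24 * K ^ 3)
  have hg : 0 < g := by positivity
  have hind : IndepFun (past x z t) θ P :=
    indepFun_of_measurable_iSup_compl h.indep h.measurable_primitives none
      (measurable_past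
        (fun s hs => measurable_iSup_compl (primitives T θ x z)
          (i := some (Sum.inl ⟨s, hs.trans ht⟩)) (by simp))
        (fun s hs => measurable_iSup_compl (primitives T θ x z)
          (i := some (Sum.inr ⟨s, hs.trans ht⟩)) (by simp)))
  have hY : Measurable (past x z t) :=
    measurable_past (fun s hs => h.measurable_context s (hs.trans ht))
      fun s hs => h.measurable_dynamic s (hs.trans ht)
  have hB : MeasurableSet {y : (ℕ → ℝ) × (ℕ → ℝ) | ∀ s < t, |y.1 s| ≤ K} := by
    have e : {y : (ℕ → ℝ) × (ℕ → ℝ) | ∀ s < t, |y.1 s| ≤ K} =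
        ⋂ s, ⋂ (_ : s < t), {y | |y.1 s| ≤ K} := by
      ext; simp
    rw [e]
    exact MeasurableSet.iInter fun s => MeasurableSet.iInter fun _ =>
      measurableSet_le (by fun_prop) measurable_const
  have e : {ω | ∀ s < t, |x s ω| ≤ K} =
      past x z t ⁻¹' {y : (ℕ → ℝ) × (ℕ → ℝ) | ∀ s < t, |y.1 s| ≤ K} := by
    ext ω
    simp only [mem_preimage, mem_ofPred_eq, past]
    exact forall₂_congr fun s hs => by rw [if_pos hs]
  rw [e]
  refine mul_le_measureReal_of_indepFun hind hY h.measurable_state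
    (measurableSet_overestimated g t) hB fun y hy => ?_
  obtain ⟨l, u, hl, hu, hlu, hI⟩ := exists_interval_eq hK y.1 y.2 t hy
  -- States in `(l, l + g/4)` have prior probability `g/8`, and the midpoint is at least `l + g/2`.
  have hIoo := real_cond_Icc_Ioo hl (by linarith : l ≤ l + g / 4) (by linarith)
  rw [h.law_state]
  calc g / 8 = (l + g / 4 - l) / 2 := by ring
    _ = _ := hIoo
    _ ≤ _ := measureReal_mono fun c hc => ?_
  have hc' : interval c y.1 y.2 t = (l, u) := hI c hc.1 (by linarith [hc.2])
  simp only [overestimated, mem_preimage, mem_ofPred_eq, hc', midpoint]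
  have h1 := hc.1
  have h2 := hc.2
  exact ⟨abs_le.2 ⟨by linarith, by linarith⟩, abs_le.2 ⟨by linarith, by linarith⟩, by linarith⟩

/-- Two product estimates: the context is drawn independently of past and state, then the dynamic
payoff independently of all three. Both windows lie in `[-1/2, 1/2]`, where the density is at least
`3/10`. -/
theorem IsEnvironment.le_measureReal_roundRegret [IsProbabilityMeasure P]
    (h : IsEnvironment P T θ x z) {t : ℕ} (ht : t < T) {g : ℝ} (hg : 0 < g) (hg1 : g ≤ 1) :
    3 / 10 * (g / 64) * (3 / 10 * (1 / 8) *
        P.real ((fun ω => (past x z t ω, θ ω)) ⁻¹' overestimated g t)) ≤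
      P.real {ω | g / 64 ≤ roundRegret (θ ω) (fun s => x s ω) (fun s => z s ω) t} := by
  have hY : Measurable (past x z t) :=
    measurable_past (fun s hs => h.measurable_context s (hs.trans ht))
      fun s hs => h.measurable_dynamic s (hs.trans ht)
  have hxt := h.measurable_context t ht
  have hO := measurableSet_overestimated g t
  have hind1 : IndepFun (fun ω => (past x z t ω, θ ω)) (x t) P :=
    indepFun_of_measurable_iSup_compl h.indep h.measurable_primitives (some (Sum.inl ⟨t, ht⟩))
      ((measurable_past
        (fun s hs => measurable_iSup_compl (primitives T θ x z)
          (i := some (Sum.inl ⟨s, hs.trans ht⟩)) (by simp [hs.ne]))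
        (fun s hs => measurable_iSup_compl (primitives T θ x z)
          (i := some (Sum.inr ⟨s, hs.trans ht⟩)) (by simp))).prodMk
      (measurable_iSup_compl (primitives T θ x z) (i := none) (by simp)))
  have hind2 : IndepFun (fun ω => ((past x z t ω, θ ω), x t ω)) (z t) P :=
    indepFun_of_measurable_iSup_compl h.indep h.measurable_primitives (some (Sum.inr ⟨t, ht⟩))
      (((measurable_past
        (fun s hs => measurable_iSup_compl (primitives T θ x z)
          (i := some (Sum.inl ⟨s, hs.trans ht⟩)) (by simp))
        (fun s hs => measurable_iSup_compl (primitives T θ x z)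
          (i := some (Sum.inr ⟨s, hs.trans ht⟩)) (by simp [hs.ne]))).prodMk
      (measurable_iSup_compl (primitives T θ x z) (i := none) (by simp))).prodMk
      (measurable_iSup_compl (primitives T θ x z) (i := some (Sum.inl ⟨t, ht⟩)) (by simp)))
  have step1 := mul_le_measureReal_of_indepFun hind1 (hY.prodMk h.measurable_state) hxt
    (hO.prod measurableSet_Icc) hO (q := 3 / 10 * (1 / 8)) (A := overestimated g t ×ˢ
      Icc (1 / 8 : ℝ) (1 / 4)) fun p hp => by
    have hx := mul_volume_le_stdGaussian (s := Icc (1 / 8 : ℝ) (1 / 4)) measurableSet_Icc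
      (Icc_subset_Icc (by norm_num) (by norm_num))
    rw [Real.volume_real_Icc_of_le (by norm_num)] at hx
    rw [h.law_context t ht, mk_preimage_prod_right hp]
    linarith
  have hA : MeasurableSet {r : ((((ℕ → ℝ) × (ℕ → ℝ)) × ℝ) × ℝ) × ℝ |
      g / 64 ≤ stepRegret r.1.1.2 r.1.2 r.2 (interval r.1.1.2 r.1.1.1.1 r.1.1.1.2 t)} :=
    measurableSet_le measurable_const (measurable_stepRegret (by fun_prop) (by fun_prop)
      (by fun_prop) ((measurable_interval_past t).comp (measurable_fst.comp measurable_fst)))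
  have step2 := mul_le_measureReal_of_indepFun hind2 ((hY.prodMk h.measurable_state).prodMk hxt)
    (h.measurable_dynamic t ht) hA (hO.prod measurableSet_Icc) (q := 3 / 10 * (g / 64))
    (B := overestimated g t ×ˢ Icc (1 / 8 : ℝ) (1 / 4)) fun p hp => by
    obtain ⟨⟨hθ, hm, hmθ⟩, hx⟩ := hp
    set m := midpoint (interval p.1.2 p.1.1.1 p.1.1.2 t) with hm_def
    have hxm : |p.2 * m| ≤ 1 / 4 := by
      rw [abs_mul, abs_of_pos (by linarith [hx.1])]
      nlinarith [abs_nonneg m, hx.1, hx.2]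
    obtain ⟨hxm1, hxm2⟩ := abs_le.1 hxm
    have hz := mul_volume_le_stdGaussian (s := Ioc (-(p.2 * m)) (-(p.2 * m) + g / 64))
      measurableSet_Ioc fun y hy => ⟨by linarith [hy.1], by linarith [hy.2]⟩
    rw [Real.volume_real_Ioc_of_le (by linarith), add_sub_cancel_left] at hz
    rw [h.law_dynamic t ht]
    exact hz.trans (measureReal_mono fun y hy => le_stepRegret hg hx hθ hm hmθ hy)
  refine (mul_le_mul_of_nonneg_left step1 (by positivity)).trans (step2.trans_eq ?_)
  simp only [preimage_ofPred_eq, interval_past]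
  rfl

/-- In every round the expected regret is at least of the order `K⁻⁹`, if the contexts are likely
to be bounded by `K`. -/
theorem IsEnvironment.le_integral_roundRegret [IsProbabilityMeasure P]
    (h : IsEnvironment P T θ x z) {t : ℕ} (ht : t < T) {K : ℝ} (hK : 1 ≤ K)
    (hP : 1 / 2 ≤ P.real {ω | ∀ s < t, |x s ω| ≤ K}) :
    9 / 52428800 * (1 / (24 * K ^ 3)) ^ 3 ≤
      ∫ ω, roundRegret (θ ω) (fun s => x s ω) (fun s => z s ω) t ∂P := by
  have h1 := h.le_measureReal_overestimated ht hK
  have hg : 0 < 1 / (24 * K ^ 3) := by positivity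
  have hg1 : 1 / (24 * K ^ 3) ≤ 1 := by
    rw [div_le_iff₀ (by positivity)]
    linarith [one_le_pow₀ hK (n := 3)]
  have h2 := h.le_measureReal_roundRegret ht hg hg1
  -- Markov's inequality at level `g/64`.
  have h3 := mul_meas_ge_le_integral_of_nonneg
    (Eventually.of_forall fun ω => stepRegret_nonneg (θ ω) (x t ω) (z t ω) _)
    (h.integrable_roundRegret ht) (1 / (24 * K ^ 3) / 64)
  set g := 1 / (24 * K ^ 3)
  refine le_trans ?_ h3
  calc 9 / 52428800 * g ^ 3
      = g / 64 * (3 / 10 * (g / 64) * (3 / 10 * (1 / 8) * (g / 8 * (1 / 2)))) := by ring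
    _ ≤ g / 64 * (3 / 10 * (g / 64) * (3 / 10 * (1 / 8) *
          (g / 8 * P.real {ω | ∀ s < t, |x s ω| ≤ K}))) := by gcongr
    _ ≤ g / 64 * (3 / 10 * (g / 64) * (3 / 10 * (1 / 8) *
          P.real ((fun ω => (past x z t ω, θ ω)) ⁻¹' overestimated g t))) := by gcongr
    _ ≤ _ := mul_le_mul_of_nonneg_left h2 (by positivity)

/-- The union bound loses at most `2 t / (T e^(5/2))`; the shift `3` makes this at most `1/2`,
because `e^(5/2) ≥ 4`. -/
theorem IsEnvironment.half_le_measureReal_forall_abs_le [IsProbabilityMeasure P]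
    (h : IsEnvironment P T θ x z) {t : ℕ} (ht : t < T) :
    1 / 2 ≤ P.real {ω | ∀ s < t, |x s ω| ≤ Real.log T + 3} := by
  have hT : (0 : ℝ) < T := by exact_mod_cast (Nat.zero_le t).trans_lt ht
  have key := le_measureReal_forall_abs_le (P := P)
    (fun s hs => h.measurable_context s (hs.trans ht))
    (fun s hs => h.law_context s (hs.trans ht)) (Real.log T + 3)
  refine le_trans ?_ key
  have e : Real.exp (1 / 2 - (Real.log T + 3)) = (T * Real.exp (5 / 2))⁻¹ := by
    rw [show 1 / 2 - (Real.log T + 3) = -(Real.log T + 5 / 2) by ring, Real.exp_neg, Real.exp_add,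
      Real.exp_log hT]
  have h4 : 4 ≤ Real.exp (5 / 2) := by
    have h1 : Real.exp 2 ≤ Real.exp (5 / 2) := Real.exp_le_exp.2 (by norm_num)
    have h2 : Real.exp 2 = Real.exp 1 * Real.exp 1 := by rw [← Real.exp_add]; norm_num
    nlinarith [Real.exp_one_gt_d9]
  have htT : (t : ℝ) ≤ T := by exact_mod_cast ht.le
  have : t * (2 * (T * Real.exp (5 / 2))⁻¹) ≤ 1 / 2 := by
    rw [← mul_assoc, ← div_eq_mul_inv, div_le_iff₀ (by positivity)]
    nlinarith
  rw [e]
  linarith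

end Environment

theorem isPolylog_const_mul_log_add_pow {a : ℝ} (ha : a ≠ 0) (b : ℝ) (n : ℕ) :
    IsPolylog fun T : ℤ => a * (Real.log T + b) ^ n := by
  refine ⟨n, ?_⟩
  have hlog : (fun _ : ℤ => b) =o[atTop] fun T : ℤ => Real.log T :=
    (Real.isLittleO_const_log_atTop (c := b)).comp_tendsto tendsto_intCast_atTop_atTop
  have h := ((Asymptotics.isTheta_refl (fun T : ℤ => Real.log T) atTop).add_isLittleO hlog).pow n
  simp only [Real.rpow_natCast]
  exact (Asymptotics.isTheta_const_mul_left ha).2 h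

end DeviationLearning

end

theorem mainTheorem1 :
    ∃ f : ℤ → ℝ, DeviationLearning.IsPolylog f ∧ (∀ T : ℤ, 0 < f T) ∧
      ∀ (T : ℕ) (_ : 1 ≤ T) (Ω : Type*) [MeasurableSpace Ω] (P : Measure Ω)
        [IsProbabilityMeasure P] (θ : Ω → ℝ) (x z : ℕ → Ω → ℝ),
        DeviationLearning.IsEnvironment P T θ x z →
        Integrable (fun ω =>
          DeviationLearning.regret (θ ω) (fun t => x t ω) (fun t => z t ω) T) P ∧
        (T : ℝ) / f (T : ℤ) ≤
          ∫ ω, DeviationLearning.regret (θ ω) (fun t => x t ω) (fun t => z t ω) T ∂P := by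
  -- This is the reciprocal of the per-round bound at `K = log T + 3`. The shift keeps it positive
  -- at every integer, since `Real.log` is nonnegative on all integers.
  refine ⟨fun T => 52428800 * 24 ^ 3 / 9 * (Real.log T + 3) ^ 9,
    DeviationLearning.isPolylog_const_mul_log_add_pow (by norm_num) 3 9, fun T => ?_,
    fun T hT Ω _ P _ θ x z h => ?_⟩
  · have : 0 ≤ Real.log T := Real.log_intCast_nonneg T
    positivity
  have hint : ∀ t ∈ Finset.range T, Integrable (fun ω =>
      DeviationLearning.roundRegret (θ ω) (fun s => x s ω) (fun s => z s ω) t) P := fun t ht =>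
    h.integrable_roundRegret (Finset.mem_range.1 ht)
  refine ⟨integrable_finsetSum _ hint, ?_⟩
  have hlog : 0 ≤ Real.log T := Real.log_natCast_nonneg T
  simp only [DeviationLearning.regret]
  rw [integral_finsetSum _ hint]
  calc (T : ℝ) / (52428800 * 24 ^ 3 / 9 * (Real.log ((T : ℤ) : ℝ) + 3) ^ 9)
      = ∑ _t ∈ Finset.range T, 9 / 52428800 * (1 / (24 * (Real.log T + 3) ^ 3)) ^ 3 := by
        rw [Finset.sum_const, Finset.card_range, nsmul_eq_mul, Int.cast_natCast]
        field_simp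
    _ ≤ _ := Finset.sum_le_sum fun t ht => h.le_integral_roundRegret (Finset.mem_range.1 ht)
        (by linarith) (h.half_le_measureReal_forall_abs_le (Finset.mem_range.1 ht))
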